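/- A \emph{D-set} is a set $\Omega$ with a quaternary relation $D(wx;yz)$ such that for all $w,x,y,z\in\Omega$: (D1) $D(wx;yz)\rightarrow D(xw;yz)\wedge D(yz;wx)$; (D2) $D(wx;yz)\rightarrow\neg D(wy;xz)$; (D3) $D(wx;yz)\rightarrow\forall v\,(D(vx;yz)\vee D(wx;yv))$; (D4) $(w\neq y\wedge x\neq y)\rightarrow D(wx;yy)$. It is \emph{dense} if it has at least two elements and $D(wx;yz)\rightarrow\exists v\,(D(vx;yz)\wedge D(wv;yz)\wedge D(wx;vz)\wedge D(wx;yv))$ for all $w,x,y,z\in\Omega$. A \emph{splitting} of $\Omega$ is a partition of $\Omega$ into at least two nonempty sets, called sectors, such that $D(ab;cd)$ holds whenever $a,b$ lie in one sector and $c,d$ lie outside that sector, and $D(ab;cd)$ fails whenever $a,b,c,d$ lie in four different sectors. A \emph{node splitting} is a splitting with more than two sectors. A D-set is \emph{regular} if all of its node splittings have the same cardinality. Corollary. Let $(\Omega,D)$ be a dense regular D-set, of any cardinality, and let $T=\mathrm{Th}(\Omega,D)$ be its complete first-order theory in the language whose only non-logical symbol is the quaternary relation symbol $D$. Then $T$ has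 quantifier elimination: for every $n\geq 0$ and every formula $\varphi(x_1,\dots,x_n)$ there is a quantifier-free formula $\psi(x_1,\dots,x_n)$ (the logical constant $\bot$ being allowed as a quantifier-free formula) such that $T\models\forall x_1\cdots\forall x_n\,(\varphi\leftrightarrow\psi)$. -/

import Mathlib

/-- `IsDSet D`: the quaternary relation `D w x y z`, written `D(wx;yz)`, makes `Ω` a D-set. -/
structure IsDSet {Ω : Type*} (D : Ω → Ω → Ω → Ω → Prop) : Prop where
  d1 : ∀ w x y z, D w x y z → D x w y z ∧ D y z w x
  d2 : ∀ w x y z, D w x y z → ¬ D w y x z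
  d3 : ∀ w x y z, D w x y z → ∀ v, D v x y z ∨ D w x y v
  d4 : ∀ w x y, w ≠ y ∧ x ≠ y → D w x y y

/-- A dense D-set: a D-set with at least two elements in which any two sides of an instance of
`D` can be separated by a further element. -/
structure IsDenseDSet {Ω : Type*} (D : Ω → Ω → Ω → Ω → Prop) : Prop extends IsDSet D where
  two_elements : Nontrivial Ω
  d6 : ∀ w x y z, D w x y z → ∃ v, D v x y z ∧ D w v y z ∧ D w x v z ∧ D w x y v

/-- A splitting of a D-set: a partition `C` of `Ω` into at least two (nonempty) sectors such that
`D(ab;cd)` holds whenever `a, b` lie in one sector and `c, d` lie outside of it, and fails whenever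
`a, b, c, d` lie in four different sectors. -/
structure IsSplitting {Ω : Type*} (D : Ω → Ω → Ω → Ω → Prop) (C : Set (Set Ω)) : Prop where
  isPartition : Setoid.IsPartition C
  two_le : 2 ≤ Cardinal.mk C
  inside : ∀ S ∈ C, ∀ a ∈ S, ∀ b ∈ S, ∀ c ∉ S, ∀ d ∉ S, D a b c d
  across : ∀ S₁ ∈ C, ∀ S₂ ∈ C, ∀ S₃ ∈ C, ∀ S₄ ∈ C,
    S₁ ≠ S₂ → S₁ ≠ S₃ → S₁ ≠ S₄ → S₂ ≠ S₃ → S₂ ≠ S₄ → S₃ ≠ S₄ →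
    ∀ a ∈ S₁, ∀ b ∈ S₂, ∀ c ∈ S₃, ∀ d ∈ S₄, ¬ D a b c d

/-- A node splitting is a splitting into more than two sectors. -/
def IsNodeSplitting {Ω : Type*} (D : Ω → Ω → Ω → Ω → Prop) (C : Set (Set Ω)) : Prop :=
  IsSplitting D C ∧ 2 < Cardinal.mk C

/-- A D-set is regular if all of its node splittings have the same cardinality. -/
def IsRegularDSet {Ω : Type*} (D : Ω → Ω → Ω → Ω → Prop) : Prop :=
  ∀ C C' : Set (Set Ω), IsNodeSplitting D C → IsNodeSplitting D C' →
    Cardinal.mk C = Cardinal.mk C'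

/-- The relation symbols of the language of D-sets: one symbol, of arity four. -/
inductive DSetRel : ℕ → Type
  | rel : DSetRel 4

/-- The first-order language of D-sets, with a single quaternary relation symbol. -/
def dSetLanguage : FirstOrder.Language.{0, 0} where
  Functions := fun _ => Empty
  Relations := DSetRel

/-- A set with a quaternary relation as a first-order structure. -/
@[reducible]
def dSetStructure {Ω : Type*} (D : Ω → Ω → Ω → Ω → Prop) : dSetLanguage.Structure Ω where
  funMap := fun f _ => Empty.elim f
  RelMap := fun {_} r =>
    match r with
    | DSetRel.rel => fun x => D (x 0) (x 1) (x 2) (x 3)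

/-- The (complete) first-order theory of `(Ω, D)`: all sentences that are true in it. -/
def dSetTheory {Ω : Type*} (D : Ω → Ω → Ω → Ω → Prop) : dSetLanguage.Theory :=
  letI := dSetStructure D
  dSetLanguage.completeTheory Ω

/-- A theory has quantifier elimination if every formula in finitely many free variables is
equivalent modulo the theory to a quantifier-free formula in the same variables. -/
def HasQuantifierElimination {L : FirstOrder.Language.{0, 0}} (T : L.Theory) : Prop :=
  ∀ (n : ℕ) (φ : L.Formula (Fin n)), ∃ ψ : L.Formula (Fin n),
    FirstOrder.Language.BoundedFormula.IsQF ψ ∧ T.ModelsBoundedFormula (φ.iff ψ)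

/-! Think of `Ω` as a set of ends of a tree, with `D w x y z` saying that the path from `w` to `x`
is disjoint from the path from `y` to `z`. Quantifier elimination follows from a back-and-forth
inside `Ω`: if finite families `a`, `b` have the same diagram, every `c` added to `a` is matched by
some `d` added to `b` (`exists_extension`). Apart from degenerate cases, `c` attaches to the tree
spanned by `a` either inside an edge, and density puts a `d` in the corresponding edge
(`exists_extension_edge`), or at a node, in a sector containing no `a i`. Regularity then gives the
corresponding node a sector free of `b` (`exists_free_sector`). Hence the diagram of a tuple decides
every formula, and a formula is equivalent to the finite disjunction of the diagrams of its
solutions. -/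

namespace IsDSet

variable {Ω : Type*} {D : Ω → Ω → Ω → Ω → Prop}

/-! ### Calculus of the relation `D` -/

theorem swapl (h : IsDSet D) {w x y z : Ω} (H : D w x y z) : D x w y z := (h.d1 _ _ _ _ H).1

theorem symm (h : IsDSet D) {w x y z : Ω} (H : D w x y z) : D y z w x := (h.d1 _ _ _ _ H).2

theorem swapr (h : IsDSet D) {w x y z : Ω} (H : D w x y z) : D w x z y :=
  h.symm (h.swapl (h.symm H))

theorem ne_left (h : IsDSet D) {w x y z : Ω} (H : D w x y z) : x ≠ y := by
  rintro rfl
  exact h.d2 _ _ _ _ H H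

theorem irrefl₁ (h : IsDSet D) (w x z : Ω) : ¬ D w x w z :=
  fun H => h.ne_left (h.swapl H) rfl

theorem irrefl₂ (h : IsDSet D) (w x z : Ω) : ¬ D w x z w :=
  fun H => h.irrefl₁ _ _ _ (h.swapr H)

theorem irrefl₃ (h : IsDSet D) (w x z : Ω) : ¬ D x w w z :=
  fun H => h.irrefl₁ _ _ _ (h.swapl H)

theorem irrefl₄ (h : IsDSet D) (w x z : Ω) : ¬ D x w z w :=
  fun H => h.irrefl₁ _ _ _ (h.swapr (h.swapl H))

theorem of_ne (h : IsDSet D) {w x y : Ω} (h1 : w ≠ y) (h2 : x ≠ y) : D w x y y :=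
  h.d4 _ _ _ ⟨h1, h2⟩

/-- Because of this, a diagram of `D` alone also records equalities. -/
theorem eq_iff (h : IsDSet D) (x y : Ω) : x = y ↔ ¬ D x x y y := by
  constructor
  · rintro rfl
    exact h.irrefl₁ _ _ _
  · intro H
    by_contra hne
    exact H (h.of_ne hne hne)

theorem left_swap_iff (h : IsDSet D) {w x y z : Ω} : D w x y z ↔ D x w y z :=
  ⟨h.swapl, h.swapl⟩

theorem symm_iff (h : IsDSet D) {w x y z : Ω} : D w x y z ↔ D y z w x :=
  ⟨h.symm, h.symm⟩

/-- `D(wx;yz)` excludes `D(wy;xz)`. -/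
theorem excl (h : IsDSet D) {w x y z : Ω} (H : D w x y z) : ¬ D w y x z := h.d2 _ _ _ _ H

theorem insert (h : IsDSet D) {w x y z : Ω} (v : Ω) (H : D w x y z) :
    D w v y z ∨ D w x y v := by
  rcases h.d3 _ _ _ _ (h.swapl H) v with H | H
  · exact Or.inl (h.swapl H)
  · exact Or.inr (h.swapl H)

theorem trans_right (h : IsDSet D) {c b x y z : Ω} (H₁ : D c b x y) (H₂ : D c b y z) :
    D c b x z := by
  rcases h.insert z H₁ with H | H
  · rcases h.insert x (h.swapr H₂) with H' | H'
    · exact absurd H' (h.excl H)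
    · exact h.swapr H'
  · exact H

theorem trans_left (h : IsDSet D) {p c q y z : Ω} (H₁ : D p c y z) (H₂ : D c q y z) :
    D p q y z :=
  h.symm (h.trans_right (h.symm H₁) (h.symm H₂))

/-- If `x` and `y` lie in the same direction from `c`, then `c` may be replaced by any `b` outside
of this direction. -/
theorem replace_iff (h : IsDSet D) {c b x y : Ω} (z : Ω) (H : D c b x y) :
    D c x y z ↔ D b x y z := by
  constructor
  · intro H'
    rcases h.d3 _ _ _ _ H' b with H'' | H''
    · exact H''
    · exact absurd (h.swapr H'') (h.excl H)
  · intro H'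
    rcases h.d3 _ _ _ _ H' c with H'' | H''
    · exact H''
    · exact absurd (h.swapl (h.symm H'')) (h.excl (h.swapr H))

/-- A finite set seen from a point `r`: for every `b` in the set there is an element branching off
from `b` as close to `r` as possible. -/
theorem exists_far (h : IsDSet D) {ι : Type*} [Finite ι] (a : ι → Ω) (r b : Ω) (S : Set ι)
    (hS : S.Nonempty) : ∃ i ∈ S, ∀ j ∈ S, ¬ D r (a j) (a i) b := by
  -- Orders the points by where they branch off the path from `b` to `r`; smaller means nearer to
  -- `r`.
  let lt : ι → ι → Prop := fun j i => D r (a j) (a i) b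
  have : IsStrictOrder ι lt :=
    { irrefl := fun i => h.irrefl₃ _ _ _
      trans := fun i j k hij hjk => by
        change D _ _ _ _
        rcases h.insert (a i) (h.swapr hjk) with H | H
        · exact h.swapr H
        · exact absurd (h.swapr H) (h.excl hij) }
  have wf : WellFounded lt := Finite.wellFounded_of_trans_of_irrefl lt
  exact ⟨wf.min S hS, wf.min_mem S hS, fun j hj => wf.not_lt_min S hj⟩

/-! ### Nodes spanned by three points -/

/-- The elements `y`, `z` lie in one sector of the node spanned by `p`, `q`, `r`. -/
def nodeRel (D : Ω → Ω → Ω → Ω → Prop) (p q r y z : Ω) : Prop :=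
  D p q y z ∨ D p r y z ∨ D q r y z

theorem nodeRel_trans_aux (h : IsDSet D) {p q r x y z : Ω}
    (H₁ : D p q x y) (H₂ : D p r y z) : D p q x z ∨ D p r x z := by
  rcases h.insert r (h.swapr H₁) with H | H
  · exact Or.inr (h.trans_right (h.swapr H) H₂)
  rcases h.insert q H₂ with H' | H'
  · exact Or.inl (h.trans_right H₁ H')
  · exact absurd (h.swapr H') (h.excl (h.swapr H))

theorem nodeRel_equivalence (h : IsDSet D) {p q r : Ω} (hpq : p ≠ q) (hpr : p ≠ r) (hqr : q ≠ r) :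
    Equivalence (nodeRel D p q r) where
  refl x := by
    by_cases hp : p = x
    · subst hp
      exact Or.inr (Or.inr (h.of_ne hpq.symm hpr.symm))
    by_cases hq : q = x
    · subst hq
      exact Or.inr (Or.inl (h.of_ne hpq hqr.symm))
    · exact Or.inl (h.of_ne hp hq)
  symm := by
    rintro x y (H | H | H)
    · exact Or.inl (h.swapr H)
    · exact Or.inr (Or.inl (h.swapr H))
    · exact Or.inr (Or.inr (h.swapr H))
  trans := by
    have aux := @nodeRel_trans_aux Ω D h
    rintro x y z (H | H | H) (H' | H' | H')
    · exact Or.inl (h.trans_right H H')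
    · have := aux H H'
      unfold nodeRel; tauto
    · have := (aux (h.swapl H) H').imp_left h.swapl
      unfold nodeRel; tauto
    · have := aux H H'
      unfold nodeRel; tauto
    · exact Or.inr (Or.inl (h.trans_right H H'))
    · have := (aux (h.swapl H) (h.swapl H')).imp h.swapl h.swapl
      unfold nodeRel; tauto
    · have := (aux H (h.swapl H')).imp_right h.swapl
      unfold nodeRel; tauto
    · have := (aux (h.swapl H) (h.swapl H')).imp h.swapl h.swapl
      unfold nodeRel; tauto
    · exact Or.inr (Or.inr (h.trans_right H H'))

theorem nodeRel_inside (h : IsDSet D) {p q r a b c d : Ω} (hab : nodeRel D p q r a b)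
    (hc : ¬ nodeRel D p q r a c) (hd : ¬ nodeRel D p q r a d) : D a b c d := by
  have aux : ∀ {u v}, D u v a b → ¬ D u v a c → ¬ D u v a d → D a b c d := by
    intro u v H h1 h2
    have H1 := (h.insert c H).resolve_right h1
    have H2 := (h.insert d H).resolve_right h2
    exact h.symm (h.trans_left (h.swapl H1) H2)
  unfold nodeRel at hc hd
  push Not at hc hd
  rcases hab with H | H | H
  · exact aux H hc.1 hd.1
  · exact aux H hc.2.1 hd.2.1
  · exact aux H hc.2.2 hd.2.2

/-- Pigeonhole: by D3 each of `p`, `q`, `r` can replace `w` or `z`. Two of them make the same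
choice, and that pair is separated from `y, z` or from `w, x`. -/
theorem nodeRel_of_rel (h : IsDSet D) {p q r w x y z : Ω} (H : D w x y z) :
    nodeRel D p q r w x ∨ nodeRel D p q r y z := by
  have one : ∀ {u v}, D u x y z → D v x y z → D u v y z :=
    fun h1 h2 => h.trans_left h1 (h.swapl h2)
  have two : ∀ {u v}, D w x y u → D w x y v → D u v w x :=
    fun h1 h2 => h.symm (h.trans_right (h.swapr h1) h2)
  unfold nodeRel
  rcases h.d3 _ _ _ _ H p with hp | hp <;> rcases h.d3 _ _ _ _ H q with hq | hq
  · have := one hp hq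
    tauto
  · rcases h.d3 _ _ _ _ H r with hr | hr
    · have := one hp hr
      tauto
    · have := two hq hr
      tauto
  · rcases h.d3 _ _ _ _ H r with hr | hr
    · have := one hq hr
      tauto
    · have := two hp hr
      tauto
  · have := two hp hq
    tauto

/-- Three distinct elements span a node splitting. -/
theorem exists_nodeSplitting (h : IsDSet D) {p q r : Ω} (hpq : p ≠ q) (hpr : p ≠ r)
    (hqr : q ≠ r) :
    ∃ s : Setoid Ω, (∀ x y, s x y ↔ nodeRel D p q r x y) ∧ IsNodeSplitting D s.classes := by
  let s : Setoid Ω := ⟨nodeRel D p q r, h.nodeRel_equivalence hpq hpr hqr⟩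
  have hs : ∀ x y, s x y ↔ nodeRel D p q r x y := fun _ _ => Iff.rfl
  have hcl : ∀ x y, {z | s z x} = {z | s z y} ↔ s x y := fun x y =>
    ⟨fun H => by
      have : x ∈ {z | s z x} := s.refl x
      rwa [H] at this,
     fun H => by
      ext z
      exact ⟨fun h' => s.trans h' H, fun h' => s.trans h' (s.symm H)⟩⟩
  have hpq' : ¬ s p q := by
    rintro (H | H | H)
    · exact h.irrefl₁ _ _ _ H
    · exact h.irrefl₁ _ _ _ H
    · exact h.irrefl₂ _ _ _ H
  have hpr' : ¬ s p r := by
    rintro (H | H | H)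
    · exact h.irrefl₁ _ _ _ H
    · exact h.irrefl₁ _ _ _ H
    · exact h.irrefl₄ _ _ _ H
  have hqr' : ¬ s q r := by
    rintro (H | H | H)
    · exact h.irrefl₃ _ _ _ H
    · exact h.irrefl₄ _ _ _ H
    · exact h.irrefl₁ _ _ _ H
  have hcard : 2 < Cardinal.mk s.classes := by
    let f : Fin 3 → s.classes := fun i => ⟨{z | s z (![p, q, r] i)}, ⟨_, rfl⟩⟩
    have hf : Function.Injective f := by
      intro i j hij
      have := (hcl _ _).1 (congrArg Subtype.val hij)
      have h1 : ¬ s q p := fun H => hpq' (s.symm H)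
      have h2 : ¬ s r p := fun H => hpr' (s.symm H)
      have h3 : ¬ s r q := fun H => hqr' (s.symm H)
      fin_cases i <;> fin_cases j <;> simp_all
    have := Cardinal.lift_mk_le_lift_mk_of_injective hf
    simp only [Cardinal.mk_fin, Cardinal.lift_natCast, Cardinal.lift_id'] at this
    refine lt_of_lt_of_le ?_ this
    exact_mod_cast (by norm_num : (2 : ℕ) < 3)
  refine ⟨s, hs, ⟨Setoid.isPartition_classes s, hcard.le, ?_, ?_⟩, hcard⟩
  · rintro _ ⟨t, rfl⟩ a ha b hb c hc d hd
    refine h.nodeRel_inside (p := p) (q := q) (r := r) ?_ ?_ ?_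
    · exact s.trans ha (s.symm hb)
    · exact fun H => hc (s.trans (s.symm H) ha)
    · exact fun H => hd (s.trans (s.symm H) ha)
  · rintro _ ⟨t₁, rfl⟩ _ ⟨t₂, rfl⟩ _ ⟨t₃, rfl⟩ _ ⟨t₄, rfl⟩ h12 - - - - h34 a ha b hb c hc d hd H
    rcases h.nodeRel_of_rel (p := p) (q := q) (r := r) H with H' | H'
    · exact h12 ((hcl _ _).2 (s.trans (s.symm ha) (s.trans H' hb)))
    · exact h34 ((hcl _ _).2 (s.trans (s.symm hc) (s.trans H' hd)))

end IsDSet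

/-! ### Diagrams and one-point extensions -/

/-- Two families of points satisfy the same instances of `D`. -/
def SameDiagram {Ω ι : Type*} (D : Ω → Ω → Ω → Ω → Prop) (a b : ι → Ω) : Prop :=
  ∀ i j k l, D (a i) (a j) (a k) (a l) ↔ D (b i) (b j) (b k) (b l)

namespace IsDSet

variable {Ω : Type*} {D : Ω → Ω → Ω → Ω → Prop}

theorem sameDiagram_eq_iff {ι : Type*} (h : IsDSet D) {a b : ι → Ω} (hab : SameDiagram D a b)
    (i j : ι) : a i = a j ↔ b i = b j := by
  rw [h.eq_iff, h.eq_iff (b i), hab i i j j]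

/-- To extend a diagram by a new point, only the instances of `D` containing it once matter. -/
theorem sameDiagram_elim (h : IsDSet D) {ι : Type*} {a b : ι → Ω} (hab : SameDiagram D a b)
    {c d : Ω} (hc : ∀ i, c ≠ a i) (hd : ∀ i, d ≠ b i)
    (H : ∀ i j k, D c (a i) (a j) (a k) ↔ D d (b i) (b j) (b k)) :
    SameDiagram D (fun o : Option ι => o.elim c a) (fun o => o.elim d b) := by
  have pair : ∀ i j, D c c (a i) (a j) ↔ D d d (b i) (b j) := fun i j =>
    ⟨fun _ => h.symm (h.of_ne (hd i).symm (hd j).symm),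
      fun _ => h.symm (h.of_ne (hc i).symm (hc j).symm)⟩
  rintro (_ | i) (_ | j) (_ | k) (_ | l) <;> simp only [Option.elim]
  · exact iff_of_false (h.irrefl₁ _ _ _) (h.irrefl₁ _ _ _)
  · exact iff_of_false (h.irrefl₁ _ _ _) (h.irrefl₁ _ _ _)
  · exact iff_of_false (h.irrefl₂ _ _ _) (h.irrefl₂ _ _ _)
  · exact pair k l
  · exact iff_of_false (h.irrefl₁ _ _ _) (h.irrefl₁ _ _ _)
  · exact iff_of_false (h.irrefl₁ _ _ _) (h.irrefl₁ _ _ _)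
  · exact iff_of_false (h.irrefl₂ _ _ _) (h.irrefl₂ _ _ _)
  · exact H j k l
  · exact iff_of_false (h.irrefl₃ _ _ _) (h.irrefl₃ _ _ _)
  · exact iff_of_false (h.irrefl₃ _ _ _) (h.irrefl₃ _ _ _)
  · exact iff_of_false (h.irrefl₄ _ _ _) (h.irrefl₄ _ _ _)
  · rw [h.left_swap_iff, h.left_swap_iff (w := b i)]
    exact H i k l
  · rw [h.symm_iff, h.symm_iff (w := b i)]
    exact pair i j
  · rw [h.symm_iff, h.symm_iff (w := b i)]
    exact H l i j
  · rw [h.symm_iff, h.symm_iff (w := b i), h.left_swap_iff, h.left_swap_iff (w := b k)]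
    exact H k i j
  · exact hab i j k l

/-- The position of a point relative to a family is determined by the equivalence relation
"lying in the same direction from this point" on the family. -/
theorem rel_iff_of_witness (h : IsDSet D) {ι : Type*} {a b : ι → Ω} (hab : SameDiagram D a b)
    {c d : Ω}
    (H : ∀ j k, (∃ i, D c (a i) (a j) (a k) ∧ D d (b i) (b j) (b k)) ∨
      ∀ i, ¬ D c (a i) (a j) (a k) ∧ ¬ D d (b i) (b j) (b k)) (i j k : ι) :
    D c (a i) (a j) (a k) ↔ D d (b i) (b j) (b k) := by
  rcases H j k with ⟨l, h1, h2⟩ | H1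
  · rcases H i j with ⟨m, h3, h4⟩ | H2
    · rw [h.replace_iff _ h3, h.replace_iff _ h4]
      exact hab m i j k
    · have h5 := (h.d3 _ _ _ _ (h.swapl h1) (a i)).resolve_right
        fun h' => (H2 l).1 (h.swapr (h.swapl h'))
      have h6 := (h.d3 _ _ _ _ (h.swapl h2) (b i)).resolve_right
        fun h' => (H2 l).2 (h.swapr (h.swapl h'))
      exact iff_of_true (h.swapl h5) (h.swapl h6)
  · exact iff_of_false (H1 i).1 (H1 i).2

/-- Seen from `c`, the points `y` and `z` lie in the opposite directions of `p` and `q`, so the path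
from `y` to `z` passes `c` and meets the path from `c` to any `x` lying in either direction. -/
theorem not_rel_across (h : IsDSet D) {c p q x y z : Ω} (hy : D c q p y) (hz : D c p q z)
    (hx : D c q p x ∨ D c p q x) : ¬ D c x y z := by
  have aux : ∀ {p q x y z}, D c q p y → D c p q z → D c q p x → ¬ D c x y z := by
    intro p q x y z hy hz hx H
    have hyx : D c q y x := h.trans_right (h.swapr hy) hx
    rcases h.d3 _ _ _ _ (h.swapl H) q with H' | H'
    · exact h.excl hz (h.trans_right hy (h.swapl H'))
    · exact h.excl (h.swapr hyx) (h.swapr (h.swapl H'))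
  rcases hx with hx | hx
  · exact aux hy hz hx
  · exact fun H => aux hz hy hx (h.swapr H)

/-- Extension of a diagram by a point inside an edge. -/
theorem exists_extension_edge (h : IsDenseDSet D) {ι : Type*} [Finite ι] {a b : ι → Ω}
    (hab : SameDiagram D a b) {c : Ω} (hc : ∀ i, c ≠ a i) {p q : ι} (hpq : a p ≠ a q)
    (H : ∀ i, D c (a q) (a p) (a i) ∨ D c (a p) (a q) (a i)) :
    ∃ d, SameDiagram D (fun o : Option ι => o.elim c a) (fun o => o.elim d b) := by
  have hD := h.toIsDSet
  -- `u` is the `p`-side index whose `b u` branches off nearest to `b q`; `v` below is its mirror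
  -- image. They bound the edge in which `d` has to lie.
  obtain ⟨u, hu, hu'⟩ := hD.exists_far b (b q) (b p) {i | D c (a q) (a p) (a i)}
    ⟨p, hD.of_ne (hc p) hpq.symm⟩
  obtain ⟨v, hv, hv'⟩ := hD.exists_far b (b p) (b q) {i | D c (a p) (a q) (a i)}
    ⟨q, hD.of_ne (hc q) hpq⟩
  have huv : D (b p) (b u) (b q) (b v) := by
    rw [← hab]
    rcases hD.d3 _ _ _ _ hu (a v) with H'' | H''
    · exact hD.symm (hD.swapl H'')
    · exact absurd H'' (hD.excl hv)
  obtain ⟨d, h1, h2, h3, h4⟩ := h.d6 _ _ _ _ huv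
  have hdp : ∀ i, D c (a q) (a p) (a i) → D d (b q) (b p) (b i) := by
    intro i hi
    rcases hD.d3 _ _ _ _ (hD.swapl (hD.symm h4)) (b i) with H' | H'
    · exact absurd (hD.swapl (hD.swapr H')) (hu' i hi)
    · exact H'
  have hdq : ∀ i, D c (a p) (a q) (a i) → D d (b p) (b q) (b i) := by
    intro i hi
    rcases hD.d3 _ _ _ _ (hD.swapl h2) (b i) with H' | H'
    · exact absurd (hD.swapl (hD.swapr H')) (hv' i hi)
    · exact H'
  have hd : ∀ i, d ≠ b i := by
    rintro i rfl
    rcases H i with H | H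
    · exact hD.irrefl₂ _ _ _ (hdp i H)
    · exact hD.irrefl₂ _ _ _ (hdq i H)
  have Hd : ∀ i, D d (b q) (b p) (b i) ∨ D d (b p) (b q) (b i) :=
    fun i => (H i).imp (hdp i) (hdq i)
  refine ⟨d, hD.sameDiagram_elim hab hc hd (hD.rel_iff_of_witness hab fun j k => ?_)⟩
  rcases H j with hj | hj <;> rcases H k with hk | hk
  · exact Or.inl ⟨q, hD.trans_right (hD.swapr hj) hk,
      hD.trans_right (hD.swapr (hdp j hj)) (hdp k hk)⟩
  · exact Or.inr fun i => ⟨hD.not_rel_across hj hk (H i),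
      hD.not_rel_across (hdp j hj) (hdq k hk) (Hd i)⟩
  · exact Or.inr fun i => ⟨hD.not_rel_across hj hk (H i).symm,
      hD.not_rel_across (hdq j hj) (hdp k hk) (Hd i).symm⟩
  · exact Or.inl ⟨p, hD.trans_right (hD.swapr hj) hk,
      hD.trans_right (hD.swapr (hdq j hj)) (hdq k hk)⟩

theorem nodeRel_congr {ι : Type*} {a b : ι → Ω} (hab : SameDiagram D a b) (p q r i j : ι) :
    nodeRel D (a p) (a q) (a r) (a i) (a j) ↔ nodeRel D (b p) (b q) (b r) (b i) (b j) := by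
  unfold nodeRel
  rw [hab, hab, hab]

/-- Supplies the common witnesses needed by `rel_iff_of_witness` when `c` lies in a sector of its
own. -/
theorem witness_of_nodeRel (h : IsDSet D) {p q r c y z : Ω} (hc : ¬ nodeRel D p q r c y) :
    (D p q y z → D c q y z) ∧ (D p r y z → D c r y z) ∧ (D q r y z → D c r y z) := by
  have aux : ∀ {u v}, ¬ D u v c y → D u v y z → D c v y z := by
    intro u v h1 H
    rcases h.d3 _ _ _ _ H c with H' | H'
    · exact H'
    · exact absurd (h.swapr H') h1
  unfold nodeRel at hc
  push Not at hc
  exact ⟨aux hc.1, aux hc.2.1, aux hc.2.2⟩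

/-- A free sector of a node persists when the diagram is transported. -/
theorem exists_free_sector (h : IsDSet D) (hreg : IsRegularDSet D) {ι : Type*} [Finite ι]
    {a b : ι → Ω} (hab : SameDiagram D a b) {p q r : ι} (hpq : a p ≠ a q) (hpr : a p ≠ a r)
    (hqr : a q ≠ a r) {c : Ω} (hc : ∀ i, ¬ nodeRel D (a p) (a q) (a r) c (a i)) :
    ∃ d, ∀ i, ¬ nodeRel D (b p) (b q) (b r) d (b i) := by
  obtain ⟨s, hs, hsn⟩ := h.exists_nodeSplitting hpq hpr hqr
  obtain ⟨t, ht, htn⟩ := h.exists_nodeSplitting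
    (mt (sameDiagram_eq_iff h hab p q).2 hpq) (mt (sameDiagram_eq_iff h hab p r).2 hpr)
    (mt (sameDiagram_eq_iff h hab q r).2 hqr)
  by_contra! hcon
  -- If every sector on the `b` side meets `b`, there are finitely many, and `g` embeds them into
  -- the sectors on the `a` side. By regularity the numbers agree, so the sectors of the `a i` are
  -- all the sectors, including that of `c`.
  obtain ⟨e⟩ := Cardinal.eq.1 (hreg _ _ hsn htn)
  have key : ∀ T : t.classes, ∃ i, T.1 = {x | t x (b i)} := by
    rintro ⟨_, x, rfl⟩
    obtain ⟨i, hi⟩ := hcon x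
    rw [← ht] at hi
    refine ⟨i, ?_⟩
    ext y
    exact ⟨fun hy => t.trans hy hi, fun hy => t.trans hy (t.symm hi)⟩
  choose f hf using key
  have hfinj : Function.Injective f := fun T T' hT => Subtype.ext (by rw [hf, hf T', hT])
  have : Finite t.classes := Finite.of_injective f hfinj
  let g : t.classes → s.classes := fun T => ⟨{x | s x (a (f T))}, ⟨_, rfl⟩⟩
  have hg : Function.Injective g := by
    intro T T' hT
    have hT : {x | s x (a (f T))} = {x | s x (a (f T'))} := congrArg Subtype.val hT
    have h1 : a (f T) ∈ {x | s x (a (f T))} := s.refl _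
    rw [hT] at h1
    have h2 : t (b (f T)) (b (f T')) := by
      rw [ht, ← nodeRel_congr hab, ← hs]
      exact h1
    refine Subtype.ext ?_
    rw [hf, hf T']
    ext y
    exact ⟨fun hy => t.trans hy h2, fun hy => t.trans hy (t.symm h2)⟩
  have hsurj : Function.Surjective (g ∘ e) := by
    have : Finite s.classes := Finite.of_equiv _ e.symm
    exact Finite.surjective_of_injective (hg.comp e.injective)
  obtain ⟨S, hS⟩ := hsurj ⟨{x | s x c}, ⟨_, rfl⟩⟩
  have h1 : c ∈ {x | s x c} := s.refl c
  rw [← show {x | s x (a (f (e S)))} = {x | s x c} from congrArg Subtype.val hS] at h1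
  exact hc _ ((hs _ _).1 h1)

/-- Extension of a diagram by a point in a free sector of a node. -/
theorem exists_extension_node (h : IsDSet D) (hreg : IsRegularDSet D) {ι : Type*} [Finite ι]
    {a b : ι → Ω} (hab : SameDiagram D a b) {p q r : ι} (hpq : a p ≠ a q) (hpr : a p ≠ a r)
    (hqr : a q ≠ a r) {c : Ω} (hc : ∀ i, ¬ nodeRel D (a p) (a q) (a r) c (a i)) :
    ∃ d, SameDiagram D (fun o : Option ι => o.elim c a) (fun o => o.elim d b) := by
  obtain ⟨d, hd⟩ := h.exists_free_sector hreg hab hpq hpr hqr hc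
  have ra := (h.nodeRel_equivalence hpq hpr hqr).refl
  have rb := (h.nodeRel_equivalence (mt (sameDiagram_eq_iff h hab p q).2 hpq)
    (mt (sameDiagram_eq_iff h hab p r).2 hpr) (mt (sameDiagram_eq_iff h hab q r).2 hqr)).refl
  refine ⟨d, h.sameDiagram_elim hab (fun i H => hc i (H ▸ ra c)) (fun i H => hd i (H ▸ rb d))
    (h.rel_iff_of_witness hab fun j k => ?_)⟩
  by_cases hjk : nodeRel D (a p) (a q) (a r) (a j) (a k)
  · left
    obtain ⟨c1, c2, c3⟩ := h.witness_of_nodeRel (z := a k) (hc j)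
    obtain ⟨d1, d2, d3⟩ := h.witness_of_nodeRel (z := b k) (hd j)
    rcases hjk with H | H | H
    · exact ⟨q, c1 H, d1 ((hab _ _ _ _).1 H)⟩
    · exact ⟨r, c2 H, d2 ((hab _ _ _ _).1 H)⟩
    · exact ⟨r, c3 H, d3 ((hab _ _ _ _).1 H)⟩
  · refine Or.inr fun i => ⟨fun H => ?_, fun H => ?_⟩
    · exact (h.nodeRel_of_rel H).elim (hc i) hjk
    · exact (h.nodeRel_of_rel H).elim (hd i) (mt (nodeRel_congr hab p q r j k).2 hjk)

/-- The back-and-forth property of dense regular D-sets. -/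
theorem exists_extension (h : IsDenseDSet D) (hreg : IsRegularDSet D) {ι : Type*} [Finite ι]
    {a b : ι → Ω} (hab : SameDiagram D a b) (c : Ω) :
    ∃ d, SameDiagram D (fun o : Option ι => o.elim c a) (fun o => o.elim d b) := by
  have hD := h.toIsDSet
  by_cases hc : ∃ i, c = a i
  · obtain ⟨i, rfl⟩ := hc
    refine ⟨b i, ?_⟩
    have key : ∀ x : ι → Ω, (fun o : Option ι => o.elim (x i) x) = x ∘ fun o => o.getD i := by
      intro x
      funext o
      cases o <;> rfl
    rw [key, key]
    exact fun _ _ _ _ => hab _ _ _ _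
  push Not at hc
  rcases isEmpty_or_nonempty ι with hι | ⟨⟨p⟩⟩
  · exact ⟨c, hD.sameDiagram_elim hab hc (fun i => hι.elim i) fun i => hι.elim i⟩
  -- `p` is arbitrary; `a q` branches off the path from `a p` to `c` as near to `c` as possible. It
  -- equals `a p` only if `a` is constant.
  obtain ⟨q, -, hq⟩ := hD.exists_far a c (a p) Set.univ ⟨p, trivial⟩
  by_cases hpq : a p = a q
  · have hall : ∀ i, a i = a p := fun i => by
      by_contra hne
      refine hq i trivial ?_
      rw [← hpq]
      exact hD.of_ne (hc p) hne
    have hall' : ∀ i, b i = b p := fun i => (sameDiagram_eq_iff hD hab i p).1 (hall i)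
    have := h.two_elements
    obtain ⟨d, hd⟩ := exists_ne (b p)
    refine ⟨d, hD.sameDiagram_elim hab hc (fun i => by rw [hall']; exact hd) fun i j k => ?_⟩
    rw [hall i, hall j, hall' i, hall' j]
    exact iff_of_false (hD.irrefl₃ _ _ _) (hD.irrefl₃ _ _ _)
  by_cases H : ∀ i, D c (a q) (a p) (a i) ∨ D c (a p) (a q) (a i)
  · exact exists_extension_edge h hab hc hpq H
  push Not at H
  -- `a r` lies on neither side of `c`, so `c` hangs off the node of `p`, `q`, `r`; the choice of
  -- `q` keeps every `a i` out of its sector.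
  obtain ⟨r, hr1, hr2⟩ := H
  have hpr : a p ≠ a r := fun h' => hr1 (h' ▸ hD.of_ne (hc p) (Ne.symm hpq))
  have hqr : a q ≠ a r := fun h' => hr2 (h' ▸ hD.of_ne (hc q) hpq)
  refine exists_extension_node hD hreg hab hpq hpr hqr (c := c) fun i => ?_
  have hi := hq i trivial
  rintro (H | H | H)
  · exact hi (hD.swapr (hD.symm H))
  · exact (hD.insert (a q) (hD.symm H)).elim hr1 fun H' => hi (hD.swapr H')
  · exact (hD.insert (a p) (hD.symm H)).elim hr2 hi

end IsDSet

/-! ### From back-and-forth to quantifier elimination -/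

open FirstOrder FirstOrder.Language

namespace IsDSet

variable {Ω : Type*} {D : Ω → Ω → Ω → Ω → Prop}

theorem exists_term_eq_var {α : Type*} (t : dSetLanguage.Term α) : ∃ i, t = Term.var i := by
  cases t with
  | var i => exact ⟨i, rfl⟩
  | func f => exact Empty.elim f

/-- Families with the same diagram satisfy the same formulas. -/
theorem realize_iff_of_sameDiagram (h : IsDenseDSet D) (hreg : IsRegularDSet D) {α : Type*}
    [Finite α] {k : ℕ} (φ : dSetLanguage.BoundedFormula α k) (v v' : α → Ω) (x x' : Fin k → Ω)
    (hv : SameDiagram D (Sum.elim v x) (Sum.elim v' x')) :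
    letI := dSetStructure D
    φ.Realize v x ↔ φ.Realize v' x' := by
  let I := dSetStructure D
  change φ.Realize v x ↔ φ.Realize v' x'
  induction φ with
  | falsum => exact Iff.rfl
  | equal t₁ t₂ =>
    obtain ⟨i, rfl⟩ := exists_term_eq_var t₁
    obtain ⟨j, rfl⟩ := exists_term_eq_var t₂
    exact sameDiagram_eq_iff h.toIsDSet hv i j
  | rel R ts =>
    cases R
    choose i hi using fun j => exists_term_eq_var (ts j)
    obtain rfl : ts = fun j => Term.var (i j) := funext hi
    exact hv (i 0) (i 1) (i 2) (i 3)
  | imp φ ψ ih₁ ih₂ => exact imp_congr (ih₁ x x' hv) (ih₂ x x' hv)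
  | @all k φ ih =>
    -- Reindexes the tuple with its new last entry as an `Option` family, the form used by
    -- `exists_extension`.
    have key : ∀ (w : α → Ω) (y : Fin k → Ω) (c : Ω), Sum.elim w (Fin.snoc y c : Fin (k + 1) → Ω) =
        (fun o : Option (α ⊕ Fin k) => o.elim c (Sum.elim w y)) ∘
          Sum.elim (fun i => some (Sum.inl i)) (Fin.snoc (fun i => some (Sum.inr i)) none) := by
      intro w y c
      funext i
      rcases i with i | i
      · rfl
      · refine Fin.lastCases ?_ (fun i => ?_) i <;> simp
    have step : ∀ {w w' : α → Ω} {y y' : Fin k → Ω},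
        SameDiagram D (Sum.elim w y) (Sum.elim w' y') → ∀ c, ∃ d,
        SameDiagram D (Sum.elim w (Fin.snoc y c : Fin (k + 1) → Ω))
          (Sum.elim w' (Fin.snoc y' d : Fin (k + 1) → Ω)) := by
      intro w w' y y' hw c
      obtain ⟨d, hd⟩ := exists_extension h hreg hw c
      refine ⟨d, ?_⟩
      rw [key, key]
      exact fun _ _ _ _ => hd _ _ _ _
    have hv' : SameDiagram D (Sum.elim v' x') (Sum.elim v x) := fun _ _ _ _ => (hv _ _ _ _).symm
    rw [BoundedFormula.realize_all, BoundedFormula.realize_all]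
    constructor
    · intro H d
      obtain ⟨c, hc⟩ := step hv' d
      exact (ih _ _ fun _ _ _ _ => (hc _ _ _ _).symm).1 (H c)
    · intro H c
      obtain ⟨d, hd⟩ := step hv c
      exact (ih _ _ hd).2 (H d)

end IsDSet

theorem isQF_foldr_inf {L : Language} {α : Type*} {n : ℕ} (l : List (L.BoundedFormula α n))
    (hl : ∀ φ ∈ l, φ.IsQF) : (l.foldr (· ⊓ ·) ⊤).IsQF := by
  induction l with
  | nil => exact BoundedFormula.IsQF.top
  | cons φ l ih =>
    exact (hl φ (by simp)).inf (ih fun ψ hψ => hl ψ (by simp [hψ]))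

theorem isQF_foldr_sup {L : Language} {α : Type*} {n : ℕ} (l : List (L.BoundedFormula α n))
    (hl : ∀ φ ∈ l, φ.IsQF) : (l.foldr (· ⊔ ·) ⊥).IsQF := by
  induction l with
  | nil => exact BoundedFormula.isQF_bot
  | cons φ l ih =>
    exact (hl φ (by simp)).sup (ih fun ψ hψ => hl ψ (by simp [hψ]))

theorem isQF_iInf {L : Language} {α β : Type*} [Finite β] {n : ℕ} (f : β → L.BoundedFormula α n)
    (hf : ∀ i, (f i).IsQF) : (BoundedFormula.iInf f).IsQF := by
  refine isQF_foldr_inf _ fun φ hφ => ?_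
  obtain ⟨i, -, rfl⟩ := List.mem_map.1 hφ
  exact hf i

theorem isQF_iSup {L : Language} {α β : Type*} [Finite β] {n : ℕ} (f : β → L.BoundedFormula α n)
    (hf : ∀ i, (f i).IsQF) : (BoundedFormula.iSup f).IsQF := by
  refine isQF_foldr_sup _ fun φ hφ => ?_
  obtain ⟨i, -, rfl⟩ := List.mem_map.1 hφ
  exact hf i

/-- The atomic formula `D(wx;yz)` in the variables with indices `i 0, …, i 3`. -/
def dSetAtom {α : Type*} (i : Fin 4 → α) : dSetLanguage.Formula α :=
  Relations.formula (L := dSetLanguage) DSetRel.rel fun j => Term.var (i j)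

open Classical in
/-- The quantifier-free formula describing a diagram, given as a set of quadruples of indices. -/
noncomputable def diagramFormula {α : Type*} [Finite α] (S : Set (Fin 4 → α)) :
    dSetLanguage.Formula α :=
  BoundedFormula.iInf fun i : Fin 4 → α => if i ∈ S then dSetAtom i else (dSetAtom i).not

theorem diagramFormula_isQF {α : Type*} [Finite α] (S : Set (Fin 4 → α)) :
    (diagramFormula S).IsQF := by
  have hatom : ∀ i : Fin 4 → α, (dSetAtom i).IsQF := fun i =>
    (BoundedFormula.IsAtomic.rel _ _).isQF
  refine isQF_iInf _ fun i => ?_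
  split_ifs
  · exact hatom i
  · exact (hatom i).not

/-- The set of quadruples of indices at which `D` holds. -/
def diagram {Ω α : Type*} (D : Ω → Ω → Ω → Ω → Prop) (v : α → Ω) : Set (Fin 4 → α) :=
  {i | D (v (i 0)) (v (i 1)) (v (i 2)) (v (i 3))}

theorem realize_diagramFormula {Ω α : Type*} [Finite α] (D : Ω → Ω → Ω → Ω → Prop)
    (S : Set (Fin 4 → α)) (v : α → Ω) :
    letI := dSetStructure D
    (diagramFormula S).Realize v ↔ diagram D v = S := by
  let I := dSetStructure D
  change (diagramFormula S).Realize v ↔ diagram D v = S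
  have hatom : ∀ i : Fin 4 → α, (dSetAtom i).Realize v ↔ i ∈ diagram D v := fun i => Iff.rfl
  rw [diagramFormula, Formula.Realize, BoundedFormula.realize_iInf, Set.ext_iff]
  refine forall_congr' fun i => ?_
  split_ifs with hi
  · exact (hatom i).trans (by simp [hi])
  · exact (not_congr (hatom i)).trans (by simp [hi])

theorem sameDiagram_of_diagram_eq {Ω α : Type*} {D : Ω → Ω → Ω → Ω → Prop} {v v' : α → Ω}
    (h : diagram D v = diagram D v') : SameDiagram D v v' := fun i j k l =>
  Set.ext_iff.1 h ![i, j, k, l]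

theorem exists_isQF_realize_iff {Ω : Type*} {D : Ω → Ω → Ω → Ω → Prop}
    (h : IsDenseDSet D) (hreg : IsRegularDSet D) {n : ℕ} (φ : dSetLanguage.Formula (Fin n)) :
    letI := dSetStructure D
    ∃ ψ : dSetLanguage.Formula (Fin n), BoundedFormula.IsQF ψ ∧
      ∀ v : Fin n → Ω, φ.Realize v ↔ ψ.Realize v := by
  let I := dSetStructure D
  -- Finite, since there are finitely many quadruples of indices. If `φ` has no solution, `X` is
  -- empty and the disjunction is `⊥`.
  let X : Set (Set (Fin 4 → Fin n)) := {S | ∃ v : Fin n → Ω, diagram D v = S ∧ φ.Realize v}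
  refine ⟨BoundedFormula.iSup fun S : X => diagramFormula S.1,
    isQF_iSup _ fun S => diagramFormula_isQF _, fun v => ?_⟩
  refine Iff.trans ?_ BoundedFormula.realize_iSup.symm
  constructor
  · exact fun hv => ⟨⟨_, v, rfl, hv⟩, (realize_diagramFormula D _ v).2 rfl⟩
  · rintro ⟨⟨S, v', rfl, hv'⟩, hS⟩
    have hS := sameDiagram_of_diagram_eq ((realize_diagramFormula D _ v).1 hS)
    refine (IsDSet.realize_iff_of_sameDiagram h hreg φ v v' default default ?_).2 hv'
    rintro (i | i) (j | j) (k | k) (l | l)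
    · exact hS i j k l
    all_goals first | exact i.elim0 | exact j.elim0 | exact k.elim0 | exact l.elim0

/-- Validity of a formula in a structure passes to the models of its complete theory. -/
theorem modelsBoundedFormula_completeTheory {L : Language} {M : Type*} [L.Structure M]
    {α : Type*} [Finite α] (φ : L.Formula α) (hφ : ∀ v : α → M, φ.Realize v) :
    (L.completeTheory M).ModelsBoundedFormula φ := by
  intro N v xs
  let σ : L.Sentence := (φ.relabel (Sum.inr : α → Empty ⊕ α)).iAlls α
  have hσ : σ ∈ L.completeTheory M := by
    rw [mem_completeTheory]
    refine Formula.realize_iAlls.2 fun w => ?_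
    rw [Formula.realize_relabel]
    exact hφ _
  have := Formula.realize_iAlls.1 (Theory.realize_sentence_of_mem (M := N) _ hσ) v
  rw [Formula.realize_relabel] at this
  rwa [Subsingleton.elim xs default]

theorem mainTheorem6 {Ω : Type*} (D : Ω → Ω → Ω → Ω → Prop)
    (hdense : IsDenseDSet D) (hregular : IsRegularDSet D) :
    HasQuantifierElimination (dSetTheory D) := by
  intro n φ
  let I := dSetStructure D
  obtain ⟨ψ, hψ, H⟩ := exists_isQF_realize_iff hdense hregular φ
  exact ⟨ψ, hψ, modelsBoundedFormula_completeTheory (M := Ω) (φ.iff ψ) fun v =>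
    Formula.realize_iff.2 (H v)⟩
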